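/- An mm-space is a triple $X=(X,d_X,\mu_X)$ where $(X,d_X)$ is a complete separable metric space and $\mu_X$ is a Borel probability measure on $X$. For mm-spaces $X,Y$ write $Y\succ X$ if there is a $1$-Lipschitz map $f:Y\to X$ with $f_*\mu_Y=\mu_X$. Let $I=[0,1)$ with Lebesgue measure $\mathcal L^1$; a parameter of $X$ is a Borel map $\varphi:I\to X$ with $\varphi_*\mathcal L^1=\mu_X$. The box distance $\square(X,Y)$ is the infimum of all $\varepsilon>0$ for which there exist a Borel set $\tilde I\subset I$ and parameters $\varphi,\psi$ of $X,Y$ with $\mathcal L^1(\tilde I)\ge 1-\varepsilon$ and $|d_X(\varphi(s),\varphi(t))-d_Y(\psi(s),\psi(t))|\le\varepsilon$ for all $s,t\in\tilde I$. The box topology is the topology induced by $\square$, and $X_m$ box-converges to $X$ if $\square(X_m,X)\to0$. Let $n\in\mathbb N\cup\{\infty\}$, let $\mathbb N_n=\{i\in\mathbb N\mid 1\le i\le n\}$, and let $\alpha=(\alpha_i)_{i\in\mathbb N_n}$ be a family of positive real numbers. For an mm-space $Y$ let $$\operatorname{diam}(Y;\alpha)=\inf\Big\{\sup_{i\in\mathbb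 N_n}\operatorname{diam}A_i\ \Big|\ (A_i)_{i\in\mathbb N_n}\text{ pairwise disjoint Borel subsets of }Y,\ \mu_Y(A_i)\ge\alpha_i\ \text{for all } i\in\mathbb N_n\Big\}\in[0,\infty],$$ where $\inf\emptyset=\infty$, and for an mm-space $X$ let $$\underline{\operatorname{diam}}(X;\alpha)=\inf_{Y\succ X}\operatorname{diam}(Y;\alpha),$$ the infimum being over all mm-spaces $Y$ with $Y\succ X$. Proposition. If a sequence $(X_m)_{m\in\mathbb N}$ of mm-spaces box-converges to an mm-space $X$, then $$\underline{\operatorname{diam}}(X;\alpha)\le\liminf_{m\to\infty}\underline{\operatorname{diam}}(X_m;\alpha).$$ In other words, $X\mapsto\underline{\operatorname{diam}}(X;\alpha)$ is lower semicontinuous with respect to the box topology. -/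

import Mathlib

universe u v

/-- An mm-space: a complete separable metric space with a Borel probability measure. -/
structure MMSpace : Type (u + 1) where
  carrier : Type u
  [metricSpace : MetricSpace carrier]
  [completeSpace : CompleteSpace carrier]
  [separableSpace : TopologicalSpace.SeparableSpace carrier]
  [measurableSpace : MeasurableSpace carrier]
  [borelSpace : BorelSpace carrier]
  measure : MeasureTheory.Measure carrier
  [isProbabilityMeasure : MeasureTheory.IsProbabilityMeasure measure]

namespace MMSpace

instance : CoeSort MMSpace.{u} (Type u) := ⟨carrier⟩

attribute [instance] metricSpace completeSpace separableSpace measurableSpace borelSpace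
  isProbabilityMeasure

/-- `Y.Dominates X` is the Lipschitz order `Y ≻ X`: there is a `1`-Lipschitz map `Y → X` pushing
the measure of `Y` forward to the measure of `X`. -/
def Dominates (Y : MMSpace.{u}) (X : MMSpace.{v}) : Prop :=
  ∃ f : Y → X, LipschitzWith 1 f ∧ MeasureTheory.Measure.map f Y.measure = X.measure

/-- The interval `I = [0, 1)`. -/
abbrev I : Type := ↥(Set.Ico (0 : ℝ) 1)

/-- Lebesgue measure `𝓛¹` on `I`. -/
noncomputable def lebesgueI : MeasureTheory.Measure I :=
  MeasureTheory.Measure.comap Subtype.val MeasureTheory.volume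

/-- A parameter of `X`: a Borel map `φ : I → X` with `φ_* 𝓛¹ = μ_X`. -/
def IsParameter (X : MMSpace.{u}) (φ : I → X) : Prop :=
  Measurable φ ∧ MeasureTheory.Measure.map φ lebesgueI = X.measure

/-- The condition on `ε` in the definition of the box distance. -/
def BoxClose (X : MMSpace.{u}) (Y : MMSpace.{v}) (ε : ℝ) : Prop :=
  ∃ (J : Set I) (φ : I → X) (ψ : I → Y),
    MeasurableSet J ∧ X.IsParameter φ ∧ Y.IsParameter ψ ∧
      ENNReal.ofReal (1 - ε) ≤ lebesgueI J ∧
      ∀ s ∈ J, ∀ t ∈ J, |dist (φ s) (φ t) - dist (ψ s) (ψ t)| ≤ ε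

/-- The box distance `□(X, Y)`, as an extended nonnegative real. -/
noncomputable def box (X : MMSpace.{u}) (Y : MMSpace.{v}) : ENNReal :=
  ⨅ (ε : ℝ) (_ : 0 < ε) (_ : BoxClose X Y ε), ENNReal.ofReal ε

/-- The box topology: the topology induced by the distance `□`. -/
instance boxTopology : TopologicalSpace MMSpace.{u} where
  IsOpen U := ∀ X ∈ U, ∃ ε : ENNReal, 0 < ε ∧ ∀ Y : MMSpace.{u}, box X Y < ε → Y ∈ U
  isOpen_univ := fun _ _ => ⟨1, one_pos, fun _ _ => trivial⟩
  isOpen_inter := by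
    rintro U V hU hV X ⟨hXU, hXV⟩
    obtain ⟨a, ha, hUa⟩ := hU X hXU
    obtain ⟨b, hb, hVb⟩ := hV X hXV
    exact ⟨min a b, lt_min ha hb, fun Y hY =>
      ⟨hUa Y (hY.trans_le (min_le_left a b)), hVb Y (hY.trans_le (min_le_right a b))⟩⟩
  isOpen_sUnion := by
    rintro S hS X ⟨U, hUS, hXU⟩
    obtain ⟨a, ha, hUa⟩ := hS U hUS X hXU
    exact ⟨a, ha, fun Y hY => ⟨U, hUS, hUa Y hY⟩⟩

/-- `ℕ_n = {i ∈ ℕ | 1 ≤ i ≤ n}` for `n ∈ ℕ ∪ {∞}`. -/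
abbrev Idx (n : ℕ∞) : Type := {i : ℕ // 1 ≤ i ∧ (i : ℕ∞) ≤ n}

/-- `D_X(α)`: families of disjoint Borel sets `A_i ⊆ X` with `μ_X(A_i) ≥ α_i` for all `i`. -/
def IsAdmissible (X : MMSpace.{u}) {n : ℕ∞} (α : Idx n → ℝ) (A : Idx n → Set X) : Prop :=
  (∀ i, MeasurableSet (A i)) ∧ Pairwise (fun i j => Disjoint (A i) (A j)) ∧
    ∀ i, ENNReal.ofReal (α i) ≤ X.measure (A i)

/-- The multivariable partial diameter `diam(X; α)`; it is `∞` if `D_X(α) = ∅`. -/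
noncomputable def partialDiam (X : MMSpace.{u}) {n : ℕ∞} (α : Idx n → ℝ) : ENNReal :=
  ⨅ (A : Idx n → Set X) (_ : X.IsAdmissible α A), ⨆ i, Metric.ediam (A i)

/-- The modified multivariable partial diameter
`udiam(X; α) = inf {diam(Y; α) | Y ≻ X}`. -/
noncomputable def udiam (X : MMSpace.{u}) {n : ℕ∞} (α : Idx n → ℝ) : ENNReal :=
  ⨅ (Y : MMSpace.{u}) (_ : Y.Dominates X), Y.partialDiam α

end MMSpace

open MeasureTheory Filter Topology
open scoped ENNReal

/-! The bound `udiam ≤ c` is traded for a condition on `X` itself, `HasSubmeasures`, which allows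
the pieces to overlap as sets and asks only that their masses fit together under `μ_X`. Pieces in a
dominating space push forward to such submeasures; conversely, overlapping submeasures are separated
by placing them on different layers of `X × ℕ`. The condition moves between box-close spaces with an
error in mass and diameter (`HasSubmeasures.of_boxClose`). The error is removed by a limit along an
ultrafilter (`hasSubmeasures_of_forall_pos`): domination by `μ_X` makes setwise limits countably
additive, and supports inherit the diameter bound. -/

/-- The setwise limit along an ultrafilter of measures dominated by a fixed finite measure. -/
theorem exists_measure_tendsto_of_le {Ω κ : Type*} [MeasurableSpace Ω] (U : Ultrafilter κ)
    (μ : Measure Ω) [IsFiniteMeasure μ] (ν : κ → Measure Ω) (hν : ∀ k, ν k ≤ μ) :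
    ∃ ρ : Measure Ω, ∀ E, MeasurableSet E → Tendsto (fun k => ν k E) U (𝓝 (ρ E)) := by
  have hL : ∀ E : Set Ω, ∃ x : ℝ≥0∞, Tendsto (fun k => ν k E) U (𝓝 x) := fun E =>
    ⟨(U.map fun k => ν k E).lim, (U.map fun k => ν k E).le_nhds_lim⟩
  choose L hL using hL
  have hLμ : ∀ E, L E ≤ μ E := fun E =>
    le_of_tendsto' (hL E) fun k => hν k E
  have hLtop : ∀ E, L E ≠ ∞ := fun E => ((hLμ E).trans_lt (measure_lt_top μ E)).ne
  have hνtop : ∀ k E, ν k E ≠ ∞ := fun k E => ((hν k E).trans_lt (measure_lt_top μ E)).ne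
  have hempty : L ∅ = 0 := by simpa using hLμ ∅
  have hUnion : ∀ f : ℕ → Set Ω, (∀ j, MeasurableSet (f j)) → Pairwise (Function.onFun Disjoint f) →
      L (⋃ j, f j) = ∑' j, L (f j) := by
    intro f hf hd
    have hsumμ : ∑' j, μ (f j) ≠ ∞ := by
      rw [← measure_iUnion hd hf]; exact measure_ne_top _ _
    have hsumL : ∑' j, L (f j) ≠ ∞ :=
      ((ENNReal.tsum_le_tsum fun j => hLμ (f j)).trans_lt hsumμ.lt_top).ne
    have h1 : Tendsto (fun k => ∑' j, (ν k (f j)).toReal) U (𝓝 (∑' j, (L (f j)).toReal)) := by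
      refine tendsto_tsum_of_dominated_convergence (bound := fun j => (μ (f j)).toReal)
        (ENNReal.summable_toReal hsumμ)
        (fun j => (ENNReal.tendsto_toReal (hLtop _)).comp (hL (f j)))
        (Eventually.of_forall fun k j => ?_)
      rw [Real.norm_of_nonneg ENNReal.toReal_nonneg]
      exact ENNReal.toReal_mono (measure_ne_top _ _) (hν k _)
    have h2 : Tendsto (fun k => (ν k (⋃ j, f j)).toReal) U (𝓝 (L (⋃ j, f j)).toReal) :=
      (ENNReal.tendsto_toReal (hLtop _)).comp (hL _)
    have h3 : ∀ k, (ν k (⋃ j, f j)).toReal = ∑' j, (ν k (f j)).toReal := fun k => by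
      rw [measure_iUnion hd hf, ENNReal.tsum_toReal_eq fun j => hνtop k _]
    simp only [h3] at h2
    have h4 := tendsto_nhds_unique h2 h1
    rw [← ENNReal.tsum_toReal_eq fun j => hLtop _] at h4
    exact (ENNReal.toReal_eq_toReal_iff' (hLtop _) hsumL).1 h4
  refine ⟨Measure.ofMeasurable (fun E _ => L E) hempty fun f hf hd => hUnion f hf hd,
    fun E hE => ?_⟩
  rw [Measure.ofMeasurable_apply E hE]
  exact hL E

namespace MMSpace

/-- A family of measures with sum at most `μ_X`, the `i`-th one of mass at least `a i` and
concentrated on a set of diameter at most `c`. -/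
def HasSubmeasures (X : MMSpace.{u}) {ι : Type*} (a : ι → ℝ≥0∞) (c : ℝ≥0∞) : Prop :=
  ∃ ν : ι → Measure X, (∀ F : Finset ι, ∑ i ∈ F, ν i ≤ X.measure) ∧
    ∀ i, a i ≤ ν i Set.univ ∧ ∃ B, MeasurableSet B ∧ Metric.ediam B ≤ c ∧ ν i Bᶜ = 0

theorem Dominates.hasSubmeasures {Y X : MMSpace.{u}} (h : Y.Dominates X) {n : ℕ∞}
    {α : Idx n → ℝ} {A : Idx n → Set Y} (hA : Y.IsAdmissible α A) {c : ℝ≥0∞}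
    (hc : ∀ i, Metric.ediam (A i) ≤ c) :
    X.HasSubmeasures (fun i => ENNReal.ofReal (α i)) c := by
  obtain ⟨f, hf, hfμ⟩ := h
  obtain ⟨hAm, hAd, hAα⟩ := hA
  have hfm : Measurable f := hf.continuous.measurable
  refine ⟨fun i => (Y.measure.restrict (A i)).map f, fun F => ?_, fun i => ⟨?_, ?_⟩⟩
  · refine Measure.le_iff.2 fun E hE => ?_
    rw [Measure.finsetSum_apply, ← hfμ, Measure.map_apply hfm hE]
    simp only [Measure.map_apply hfm hE, Measure.restrict_apply (hfm hE)]
    rw [← measure_biUnion_finset (fun i _ j _ hij => (hAd hij).mono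
      Set.inter_subset_right Set.inter_subset_right) fun i _ => (hfm hE).inter (hAm i)]
    exact measure_mono (Set.iUnion₂_subset fun i _ => Set.inter_subset_left)
  · rw [Measure.map_apply hfm MeasurableSet.univ]
    simpa using hAα i
  -- The image of a Borel set need not be Borel; its closure is, with the same diameter.
  · refine ⟨closure (f '' A i), isClosed_closure.measurableSet, ?_, ?_⟩
    · rw [Metric.ediam_closure]
      simpa using (hf.ediam_image_le (A i)).trans (by simpa using hc i)
    · rw [Measure.map_apply hfm isClosed_closure.measurableSet.compl,
        Measure.restrict_apply (hfm isClosed_closure.measurableSet.compl)]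
      convert measure_empty (μ := Y.measure)
      ext y
      simp only [Set.mem_inter_iff, Set.mem_preimage, Set.mem_compl_iff, Set.mem_empty_iff_false,
        iff_false, not_and]
      exact fun hy hyA => hy (subset_closure ⟨y, hyA, rfl⟩)

theorem hasSubmeasures_of_udiam_lt {X : MMSpace.{u}} {n : ℕ∞} {α : Idx n → ℝ} {c : ℝ≥0∞}
    (h : X.udiam α < c) : X.HasSubmeasures (fun i => ENNReal.ofReal (α i)) c := by
  simp only [udiam, partialDiam, iInf_lt_iff] at h
  obtain ⟨Y, hY, A, hA, hc⟩ := h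
  exact hY.hasSubmeasures hA fun i => (le_iSup (fun i => Metric.ediam (A i)) i).trans hc.le

theorem HasSubmeasures.udiam_le {X : MMSpace.{u}} {n : ℕ∞} {α : Idx n → ℝ} {c : ℝ≥0∞}
    (h : X.HasSubmeasures (fun i => ENNReal.ofReal (α i)) c) : X.udiam α ≤ c := by
  obtain ⟨ν, hsum, hν⟩ := h
  choose hmass B hBm hBc hB0 using hν
  have hσ : Measure.sum ν ≤ X.measure := Measure.le_iff.2 fun E hE => by
    rw [Measure.sum_apply _ hE, ENNReal.tsum_eq_iSup_sum]
    refine iSup_le fun F => ?_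
    simpa [Measure.finsetSum_apply] using hsum F E
  have : IsFiniteMeasure (Measure.sum ν) := isFiniteMeasure_of_le _ hσ
  have hm : ∀ k : ℕ, Measurable fun x : X => (x, k) := fun k => measurable_id.prodMk measurable_const
  -- The leftover mass makes the first marginal exactly `μ_X`. Its layer is immaterial, since
  -- admissibility asks only for lower bounds on mass.
  let ρ : Measure (X × ℕ) := Measure.sum (fun i => (ν i).map fun x => (x, (i : ℕ))) +
    (X.measure - Measure.sum ν).map fun x => (x, 0)
  have hfst : ρ.map Prod.fst = X.measure := by
    rw [Measure.map_add _ _ measurable_fst, Measure.map_sum measurable_fst.aemeasurable,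
      Measure.map_map measurable_fst (hm 0)]
    simp only [Measure.map_map measurable_fst (hm _), Function.comp_def, Measure.map_id']
    rw [add_comm, Measure.sub_add_cancel_of_le hσ]
  have : IsProbabilityMeasure (ρ.map Prod.fst) := hfst ▸ X.isProbabilityMeasure
  have : IsProbabilityMeasure ρ := Measure.isProbabilityMeasure_of_map Prod.fst
  let Y : MMSpace.{u} := { carrier := X × ℕ, measure := ρ }
  have hY : Y.Dominates X := ⟨Prod.fst, LipschitzWith.prod_fst, hfst⟩
  have hA : Y.IsAdmissible α fun i => B i ×ˢ {(i : ℕ)} := by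
    refine ⟨fun i => (hBm i).prod (measurableSet_singleton _), fun i j hij => ?_, fun i => ?_⟩
    · refine Set.disjoint_left.2 fun z hz hz' => hij (Subtype.ext ?_)
      exact (Set.mem_singleton_iff.1 hz.2).symm.trans (Set.mem_singleton_iff.1 hz'.2)
    · have hmeas : MeasurableSet (B i ×ˢ {(i : ℕ)} : Set (X × ℕ)) :=
        (hBm i).prod (measurableSet_singleton _)
      calc ENNReal.ofReal (α i) ≤ ν i Set.univ := hmass i
        _ = ν i (B i) := by
          rw [← measure_add_measure_compl (hBm i), hB0, add_zero]
        _ = (ν i).map (fun x => (x, (i : ℕ))) (B i ×ˢ {(i : ℕ)}) := by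
          rw [Measure.map_apply (hm _) hmeas]
          congr 1
          ext x
          simp
        _ ≤ ρ (B i ×ˢ {(i : ℕ)}) :=
          (Measure.le_sum (fun i : Idx n => (ν i).map fun x => (x, (i : ℕ))) i _).trans
            (by rw [Measure.add_apply]; exact le_self_add)
  calc X.udiam α ≤ Y.partialDiam α := iInf₂_le Y hY
    _ ≤ ⨆ i, Metric.ediam (B i ×ˢ {(i : ℕ)} : Set (X × ℕ)) := iInf₂_le _ hA
    _ ≤ c := iSup_le fun i => Metric.ediam_le fun z hz w hw => by
      have h2 : z.2 = w.2 :=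
        (Set.mem_singleton_iff.1 hz.2).trans (Set.mem_singleton_iff.1 hw.2).symm
      rw [Prod.edist_eq, h2, edist_self, max_eq_left zero_le]
      exact Metric.edist_le_of_ediam_le hz.1 hw.1 (hBc i)

/-- Pull the density of each `ν i` back along `φ`, cut it to `J`, and push forward along `ψ`.
Densities are at most `1` a.e., so the cut costs mass at most `ε`; on `J` distances change by at
most `ε`. -/
theorem HasSubmeasures.of_boxClose {X Y : MMSpace.{u}} {ε : ℝ} (h : BoxClose X Y ε)
    {ι : Type*} {a : ι → ℝ≥0∞} {c : ℝ≥0∞} (hX : X.HasSubmeasures a c) :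
    Y.HasSubmeasures (fun i => a i - ENNReal.ofReal ε) (c + ENNReal.ofReal ε) := by
  obtain ⟨J, φ, ψ, hJ, ⟨hφ, hφμ⟩, ⟨hψ, hψμ⟩, hJε, hdist⟩ := h
  obtain ⟨ν, hsum, hν⟩ := hX
  have : IsProbabilityMeasure (lebesgueI.map φ) := hφμ ▸ X.isProbabilityMeasure
  have : IsProbabilityMeasure lebesgueI := Measure.isProbabilityMeasure_of_map φ
  have hle : ∀ i, ν i ≤ X.measure := fun i => by simpa using hsum {i}
  have : ∀ i, IsFiniteMeasure (ν i) := fun i => isFiniteMeasure_of_le _ (hle i)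
  let g : ι → X → ℝ≥0∞ := fun i => (ν i).rnDeriv X.measure
  have hg : ∀ i, Measurable (g i) := fun i => Measure.measurable_rnDeriv _ _
  have hgν : ∀ i E, MeasurableSet E → ∫⁻ x in E, g i x ∂X.measure = ν i E := fun i E hE => by
    rw [Measure.setLIntegral_rnDeriv (Measure.absolutelyContinuous_of_le (hle i))]
  have hgφ : ∀ i E, MeasurableSet E → ∫⁻ s in φ ⁻¹' E, g i (φ s) ∂lebesgueI = ν i E :=
    fun i E hE => by rw [← hgν i E hE, ← hφμ, setLIntegral_map hE (hg i) hφ]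
  have hg1 : ∀ F : Finset ι, ∀ᵐ s ∂lebesgueI, ∑ i ∈ F, g i (φ s) ≤ 1 := fun F => by
    have : ∀ᵐ x ∂X.measure, ∑ i ∈ F, g i x ≤ 1 := by
      refine ae_le_of_forall_setLIntegral_le_of_sigmaFinite
        (Finset.measurable_fun_sum F fun i _ => hg i) fun E hE _ => ?_
      rw [lintegral_finsetSum _ fun i _ => hg i, setLIntegral_one]
      simp only [hgν _ E hE]
      simpa [Measure.finsetSum_apply] using hsum F E
    rw [← hφμ] at this
    exact ae_of_ae_map hφ.aemeasurable this
  have hval : ∀ i E, MeasurableSet E →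
      (((lebesgueI.restrict J).withDensity fun s => g i (φ s)).map ψ) E =
        ∫⁻ s in ψ ⁻¹' E ∩ J, g i (φ s) ∂lebesgueI := fun i E hE => by
    rw [Measure.map_apply hψ hE, withDensity_apply _ (hψ hE), Measure.restrict_restrict (hψ hE)]
  refine ⟨fun i => ((lebesgueI.restrict J).withDensity fun s => g i (φ s)).map ψ,
    fun F => Measure.le_iff.2 fun E hE => ?_, fun i => ⟨?_, ?_⟩⟩
  · rw [Measure.finsetSum_apply]
    simp only [hval _ E hE]
    rw [← lintegral_finsetSum F (f := fun i s => g i (φ s)) fun i _ => (hg i).comp hφ, ← hψμ, Measure.map_apply hψ hE]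
    calc ∫⁻ s in ψ ⁻¹' E ∩ J, ∑ i ∈ F, g i (φ s) ∂lebesgueI
        ≤ ∫⁻ s in ψ ⁻¹' E ∩ J, 1 ∂lebesgueI := lintegral_mono_ae (ae_restrict_of_ae (hg1 F))
      _ ≤ lebesgueI (ψ ⁻¹' E) := by
        rw [setLIntegral_one]; exact measure_mono Set.inter_subset_left
  · rw [hval i _ MeasurableSet.univ, Set.preimage_univ, Set.univ_inter, tsub_le_iff_right]
    have hJc : lebesgueI Jᶜ ≤ ENNReal.ofReal ε := by
      rw [prob_compl_eq_one_sub hJ, tsub_le_iff_right]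
      calc (1 : ℝ≥0∞) = ENNReal.ofReal (ε + (1 - ε)) := by simp
        _ ≤ ENNReal.ofReal ε + ENNReal.ofReal (1 - ε) := ENNReal.ofReal_add_le
        _ ≤ _ := by gcongr
    calc a i ≤ ν i Set.univ := (hν i).1
      _ = ∫⁻ s, g i (φ s) ∂lebesgueI := by
        rw [← hgφ i _ MeasurableSet.univ, Set.preimage_univ, Measure.restrict_univ]
      _ = ∫⁻ s in J, g i (φ s) ∂lebesgueI + ∫⁻ s in Jᶜ, g i (φ s) ∂lebesgueI :=
        (lintegral_add_compl _ hJ).symm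
      _ ≤ ∫⁻ s in J, g i (φ s) ∂lebesgueI + ∫⁻ s in Jᶜ, 1 ∂lebesgueI := by
        gcongr 1
        exact lintegral_mono_ae (ae_restrict_of_ae (by simpa using hg1 {i}))
      _ ≤ _ := by rw [setLIntegral_one]; gcongr
  · obtain ⟨-, B, hB, hBc, hB0⟩ := hν i
    have hC := (isClosed_closure (s := ψ '' (φ ⁻¹' B ∩ J))).measurableSet
    refine ⟨closure (ψ '' (φ ⁻¹' B ∩ J)), hC, ?_, ?_⟩
    · rw [Metric.ediam_closure, Metric.ediam_image_le_iff]
      rintro s ⟨hsB, hsJ⟩ t ⟨htB, htJ⟩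
      have hst : dist (ψ s) (ψ t) ≤ dist (φ s) (φ t) + ε := by
        linarith [(abs_le.1 (hdist s hsJ t htJ)).1]
      calc edist (ψ s) (ψ t) ≤ ENNReal.ofReal (dist (φ s) (φ t) + ε) := by
            rw [edist_dist]; exact ENNReal.ofReal_le_ofReal hst
        _ ≤ edist (φ s) (φ t) + ENNReal.ofReal ε := by
            rw [edist_dist]; exact ENNReal.ofReal_add_le
        _ ≤ _ := by
            gcongr
            exact Metric.edist_le_of_ediam_le hsB htB hBc
    · rw [hval i _ hC.compl]
      refine le_antisymm ?_ zero_le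
      rw [← hB0, ← hgφ i _ hB.compl]
      refine lintegral_mono_set ?_
      rintro s ⟨hs, hsJ⟩ hsB
      exact hs (subset_closure ⟨s, ⟨hsB, hsJ⟩, rfl⟩)

theorem hasSubmeasures_of_forall_pos {X : MMSpace.{u}} {ι : Type*} {a : ι → ℝ≥0∞} {c : ℝ≥0∞}
    (h : ∀ δ : ℝ≥0∞, 0 < δ → X.HasSubmeasures (fun i => a i - δ) (c + δ)) :
    X.HasSubmeasures a c := by
  obtain ⟨δ, -, hδpos, hδ⟩ := exists_seq_strictAnti_tendsto' (zero_lt_one (α := ℝ≥0∞))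
  choose ν hsum hν using fun k => h (δ k) (hδpos k).1
  choose hmass B hBm hBc hB0 using hν
  let U : Ultrafilter ℕ := hyperfilter ℕ
  have hδU : Tendsto δ U (𝓝 0) := hδ.mono_left Nat.hyperfilter_le_atTop
  have hle : ∀ i k, ν k i ≤ X.measure := fun i k => by simpa using hsum k {i}
  choose ρ hρ using fun i => exists_measure_tendsto_of_le U X.measure (fun k => ν k i) (hle i)
  refine ⟨ρ, fun F => Measure.le_iff.2 fun E hE => ?_, fun i => ⟨?_, ?_⟩⟩
  · rw [Measure.finsetSum_apply]
    refine le_of_tendsto' (tendsto_finsetSum F fun i _ => hρ i E hE) fun k => ?_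
    simpa [Measure.finsetSum_apply] using hsum k F E
  · have := (hρ i _ MeasurableSet.univ).add hδU
    rw [add_zero] at this
    exact ge_of_tendsto' this fun k => tsub_le_iff_right.1 (hmass k i)
  -- The sets `B k i` need not converge. But a ball around a support point has positive limit mass,
  -- so it meets `B k i` for `U`-almost all `k`; two support points can be served by the same `k`.
  · refine ⟨(ρ i).support, Measure.isClosed_support.measurableSet, ?_,
      Measure.measure_compl_support⟩
    refine Metric.ediam_le fun x hx y hy => ?_
    have hball : ∀ z ∈ (ρ i).support, ∀ r : ℝ≥0∞, 0 < r →
        ∀ᶠ k in U, (B k i ∩ Metric.eball z r).Nonempty := by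
      intro z hz r hr
      have hpos := Measure.mem_support_iff_forall z |>.1 hz _ (Metric.eball_mem_nhds z hr)
      filter_upwards [(hρ i _ Metric.isOpen_eball.measurableSet).eventually_ne hpos.ne'] with k hk
      by_contra hne
      refine hk (measure_mono_null ?_ (hB0 k i))
      exact fun w hw hwB => hne ⟨w, hwB, hw⟩
    refine ENNReal.le_of_forall_pos_le_add fun r hr _ => ?_
    have hr3 : (0 : ℝ≥0∞) < (r : ℝ≥0∞) / 3 := by
      exact ENNReal.div_pos (by exact_mod_cast hr.ne') (by simp)
    obtain ⟨k, ⟨⟨x', hx'B, hx'⟩, ⟨y', hy'B, hy'⟩⟩, hk⟩ :=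
      (((hball x hx _ hr3).and (hball y hy _ hr3)).and (hδU.eventually_lt_const hr3)).exists
    calc edist x y ≤ edist x x' + edist x' y' + edist y' y := edist_triangle4 _ _ _ _
      _ ≤ (r : ℝ≥0∞) / 3 + (c + (r : ℝ≥0∞) / 3) + (r : ℝ≥0∞) / 3 := by
        gcongr
        · rw [edist_comm]; exact (Metric.mem_eball.1 hx').le
        · exact (Metric.edist_le_of_ediam_le hx'B hy'B (hBc k i)).trans (by gcongr)
        · exact (Metric.mem_eball.1 hy').le
      _ = c + ((r : ℝ≥0∞) / 3 + (r : ℝ≥0∞) / 3 + (r : ℝ≥0∞) / 3) := by ring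
      _ = c + r := by rw [ENNReal.add_thirds]

theorem exists_boxClose_of_box_lt {X Y : MMSpace.{u}} {δ : ℝ≥0∞} (h : box X Y < δ) :
    ∃ ε : ℝ, BoxClose X Y ε ∧ ENNReal.ofReal ε < δ := by
  simp only [box, iInf_lt_iff] at h
  obtain ⟨ε, -, hε, hlt⟩ := h
  exact ⟨ε, hε, hlt⟩

theorem BoxClose.symm {X Y : MMSpace.{u}} {ε : ℝ} (h : BoxClose X Y ε) : BoxClose Y X ε := by
  obtain ⟨J, φ, ψ, hJ, hφ, hψ, hJε, hd⟩ := h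
  exact ⟨J, ψ, φ, hJ, hψ, hφ, hJε, fun s hs t ht => by rw [abs_sub_comm]; exact hd s hs t ht⟩

theorem box_comm (X Y : MMSpace.{u}) : box X Y = box Y X := by
  have : ∀ ε, BoxClose X Y ε ↔ BoxClose Y X ε := fun ε => ⟨BoxClose.symm, BoxClose.symm⟩
  simp only [box, this]

/-- If spaces with `udiam` below `c` are arbitrarily box-close to `X`, then `udiam X ≤ c`. -/
theorem udiam_le_of_forall_box_lt {X : MMSpace.{u}} {n : ℕ∞} {α : Idx n → ℝ} {c : ℝ≥0∞}
    (h : ∀ δ : ℝ≥0∞, 0 < δ → ∃ Y : MMSpace.{u}, box Y X < δ ∧ Y.udiam α < c) :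
    X.udiam α ≤ c := by
  refine (hasSubmeasures_of_forall_pos fun δ hδ => ?_).udiam_le
  obtain ⟨Y, hbox, hY⟩ := h δ hδ
  obtain ⟨ε, hε, hlt⟩ := exists_boxClose_of_box_lt hbox
  obtain ⟨ν, hsum, hν⟩ := (hasSubmeasures_of_udiam_lt hY).of_boxClose hε
  refine ⟨ν, hsum, fun i => ⟨(tsub_le_tsub_left hlt.le _).trans (hν i).1, ?_⟩⟩
  obtain ⟨B, hB, hBc, hB0⟩ := (hν i).2
  exact ⟨B, hB, hBc.trans (by gcongr), hB0⟩

end MMSpace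

theorem mainTheorem5 {n : ℕ∞} (α : MMSpace.Idx n → ℝ) (hα : ∀ i, 0 < α i) :
    (∀ (X : ℕ → MMSpace.{u}) (X' : MMSpace.{u}),
      Filter.Tendsto (fun m => MMSpace.box (X m) X') Filter.atTop (nhds 0) →
        X'.udiam α ≤ Filter.liminf (fun m => (X m).udiam α) Filter.atTop) ∧
    LowerSemicontinuous (fun X : MMSpace.{u} => X.udiam α) := by
  refine ⟨fun X X' hX => le_of_forall_gt_imp_ge_of_dense fun c hc => ?_, ?_⟩
  · refine MMSpace.udiam_le_of_forall_box_lt fun δ hδ => ?_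
    obtain ⟨m, hm, hm'⟩ :=
      ((frequently_lt_of_liminf_lt (by isBoundedDefault) hc).and_eventually
        (hX.eventually_lt_const hδ)).exists
    exact ⟨X m, hm', hm⟩
  · refine lowerSemicontinuous_iff_isOpen_preimage.2 fun y X (hX : y < X.udiam α) => ?_
    obtain ⟨c, hyc, hcX⟩ := exists_between hX
    by_contra hcon
    -- If no box ball around `X` lies in the superlevel set of `y`, each one contains a space with
    -- `udiam` below `c`.
    refine hcX.not_ge (MMSpace.udiam_le_of_forall_box_lt fun δ hδ => ?_)
    by_contra! hno
    refine hcon ⟨δ, hδ, fun Y hY => hyc.trans_le (hno Y ?_)⟩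
    rwa [MMSpace.box_comm]
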